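/- For a finite simple graph $G$ with diagonal degree matrix $D(G)$ and adjacency matrix $A(G)$, and for a real number $\alpha\in[0,1)$, let $A_\alpha(G)=\alpha D(G)+(1-\alpha)A(G)$ and let $\rho_\alpha(G)$ be the spectral radius of $A_\alpha(G)$. Let $\Theta$ be the graph on $\{w_1,w_2,w_3,w_4\}$ obtained from the complete graph $K_4$ by deleting the edge $w_1w_3$ (so $w_1,w_3$ have degree $2$ and $w_2,w_4$ have degree $3$). For integers $s,a,b\ge 0$: - $\Theta_4(s;a,b)$ is the graph obtained from $\Theta$ by attaching $s$ pendant edges and a pendant path of length $a$ to $w_1$, and a pendant path of length $b$ to $w_3$; - $\Theta_5(s;a,b)$ is the graph obtained from $\Theta$ by attaching $s$ pendant edges to $w_2$, a pendant path of length $a$ to $w_1$, and a pendant path of length $b$ to $w_3$. For $i\in\{4,5\}$ let $\Theta_i(n,d)$ be the set of all graphs (up to isomorphism) of the form $\Theta_i(s;a,b)$, $s,a,b\ge 0$, that have $n$ vertices and diameter $d$. Let $\alpha\in[0,1)$ and $d\ge 4$. Then for every $H_1\in\Theta_4(n,d)$, other than (for $n=d+2$) the graph $\Theta_4\big(0;\lceil\tfrac{d-2}{2}\rceil,\lfloor\tfrac{d-2}{2}\rfloor\big)=\Theta_5\big(0;\lceil\tfrac{d-2}{2}\rceil,\lfloor\tfrac{d-2}{2}\rfloor\big)$,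 there exists a graph $H_2\in\Theta_5(n,d)$ such that $\rho_\alpha(H_1)<\rho_\alpha(H_2)$. -/

import Mathlib

open scoped ENNReal

namespace AlphaSpectral

open Classical in
/-- The matrix `A_α(G) = α D(G) + (1 - α) A(G)`, where `D(G)` is the diagonal matrix of vertex
degrees and `A(G)` is the adjacency matrix. -/
noncomputable def alphaMatrix {V : Type*} [Fintype V] [DecidableEq V] (α : ℝ)
    (G : SimpleGraph V) : Matrix V V ℝ :=
  α • G.degMatrix ℝ + (1 - α) • G.adjMatrix ℝ

/-- The `α`-spectral radius `ρ_α(G)`, i.e. the largest modulus of an eigenvalue of `A_α(G)`.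
The matrix `A_α(G)` is real symmetric, so all its complex eigenvalues are real and its real
spectrum is its whole spectrum. -/
noncomputable def alphaSpectralRadius {V : Type*} [Fintype V] [DecidableEq V] (α : ℝ)
    (G : SimpleGraph V) : ℝ≥0∞ :=
  spectralRadius ℝ (alphaMatrix α G)

/-- The bicyclic graph `Θ` of order 4 (the complete graph on 4 vertices minus an edge). The
vertices `w₁, w₂, w₃, w₄` are `0, 1, 2, 3`; the missing edge is `w₁w₃`, so `w₁, w₃` have degree 2
and `w₂, w₄` have degree 3. -/
def thetaBase : SimpleGraph (Fin 4) :=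
  (⊤ : SimpleGraph (Fin 4)).deleteEdges {s(0, 2)}

/-- Vertices of a graph obtained from one on `Fin 4` by attaching `s` pendant edges and two pendant
paths of lengths `a` and `b`. Only the new vertices of each attached piece are listed: the `Fin s`
summand holds the `s` pendant vertices; in the `Fin a` summand, `i` is the vertex at distance
`i + 1` from the root of the first path; likewise for `Fin b` and the second path. -/
abbrev AttachVertex (s a b : ℕ) : Type := Fin 4 ⊕ Fin s ⊕ Fin a ⊕ Fin b

/-- The (directed) edges of the attached graph: the `s` pendant edges are attached at `u`, the path
of length `a` at `v` and the path of length `b` at `w`. -/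
def attachRel (u v w : Fin 4) (s a b : ℕ) : AttachVertex s a b → AttachVertex s a b → Prop
  | .inl x, .inl y => thetaBase.Adj x y
  | .inl x, .inr (.inl _) => x = u
  | .inl x, .inr (.inr (.inl i)) => x = v ∧ i.val = 0
  | .inl x, .inr (.inr (.inr i)) => x = w ∧ i.val = 0
  | .inr (.inr (.inl i)), .inr (.inr (.inl j)) => i.val + 1 = j.val
  | .inr (.inr (.inr i)), .inr (.inr (.inr j)) => i.val + 1 = j.val
  | _, _ => False

/-- The graph obtained from `Θ` by attaching `s` pendant edges to the vertex `u`, a pendant path of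
length `a` to `v`, and a pendant path of length `b` to `w`. -/
def attach (u v w : Fin 4) (s a b : ℕ) : SimpleGraph (AttachVertex s a b) :=
  SimpleGraph.fromRel (attachRel u v w s a b)

/-- `Θ₄(s; a, b)`: `s` pendant edges and a pendant path of length `a` at `w₁`, a pendant path of
length `b` at `w₃`. -/
def theta4 (s a b : ℕ) : SimpleGraph (AttachVertex s a b) := attach 0 0 2 s a b

/-- `Θ₅(s; a, b)`: `s` pendant edges at `w₂`, a pendant path of length `a` at `w₁`, a pendant path
of length `b` at `w₃`. -/
def theta5 (s a b : ℕ) : SimpleGraph (AttachVertex s a b) := attach 1 0 2 s a b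

/-- The class `Θ₄(n, d)` of all graphs `Θ₄(s; a, b)` with `n` vertices and diameter `d`
(up to isomorphism, on the vertex set `Fin n`). -/
def Theta4Class (n d : ℕ) : Set (SimpleGraph (Fin n)) :=
  {G | G.diam = d ∧ ∃ s a b : ℕ, Nonempty (G ≃g theta4 s a b)}

/-- The class `Θ₅(n, d)` of all graphs `Θ₅(s; a, b)` with `n` vertices and diameter `d`
(up to isomorphism, on the vertex set `Fin n`). -/
def Theta5Class (n d : ℕ) : Set (SimpleGraph (Fin n)) :=
  {G | G.diam = d ∧ ∃ s a b : ℕ, Nonempty (G ≃g theta5 s a b)}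

end AlphaSpectral

/-! The comparison is by test vectors. Let `ρ` be the Perron eigenvalue of a graph `Θ₄(s; a, b)`. If
a connected graph carries a nonnegative `y` with `ρ y ≤ A_α y`, strict somewhere, then pairing with
its positive Perron vector shows that its `α`-spectral radius exceeds `ρ`
(`ofReal_lt_alphaSpectralRadius`).

Put `κ = (ρ - 2α)/(1 - α)` and `β = α/(1 - α)`. Along a pendant path the eigenvalue equations are
solved by the ratios `τ₀ = -β`, `τₘ₊₁ = 1/(κ - τₘ)`, so a path of length `m` acts on its root as a
diagonal weight `β + τₘ`, and `s` pendant edges as `c = s(β + τ₁)`. Eliminating the paths leaves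
four equations on `Θ`. For `Θ₄` they give `h = 2 + 2/w + 2/v`, where `h = κ - β + 1`, `w = κ - β -
τ_a - c`, `v = κ - β - τ_b` (`theta4_relations`). For `Θ₅(s; a', b')` a vector solving every
equation except those at `w₂` and `w₄` is a strict test vector as soon as `1 < (1 + 1/u + 1/v')(1/h
+ 1/(h - c))`, where `u = κ - β - τ_{a'}` and `v' = κ - β - τ_{b'}`
(`lt_alphaSpectralRadius_theta5`).

If `s > 0` and `a ≥ 1`, this inequality holds for `(a', b') = (a, b)` or for `(a - 1, b + 1)`,
according to the sizes of `w` and `v τ_a` (`one_lt_of_le_left`, `one_lt_of_lt_right`). If `s = 0`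
the two families coincide, and shifting `Θ` towards the middle of the long path wins because `m ↦
1/(κ - β - τₘ)` is strictly concave (`one_div_sub_pathRatio_add_lt`); only the balanced graph admits
no such shift. -/

namespace AlphaSpectral
open Matrix

/-! ### Perron–Frobenius facts for symmetric nonnegative matrices. -/

section Perron

variable {V : Type*} [Fintype V]

/-- A real symmetric matrix with nonnegative entries has a nonnegative eigenvector. -/
theorem exists_nonneg_eigenvector [Nonempty V] [DecidableEq V] (M : Matrix V V ℝ)
    (hs : M.IsSymm) (hM : ∀ i j, 0 ≤ M i j) :
    ∃ (ρ : ℝ) (x : V → ℝ), (∀ v, 0 ≤ x v) ∧ x ≠ 0 ∧ M *ᵥ x = ρ • x := by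
  set T := Matrix.toEuclideanCLM (𝕜 := ℝ) M with hT
  have hsa : IsSelfAdjoint T := by
    rw [hT, IsSelfAdjoint, ← map_star]
    congr 1
  have hform : ∀ x : EuclideanSpace ℝ V,
      T.reApplyInnerSelf x = ∑ i, ∑ j, M i j * x j * x i := by
    intro x
    rw [ContinuousLinearMap.reApplyInnerSelf_apply, PiLp.inner_apply]
    simp only [hT, Matrix.ofLp_toEuclideanCLM, Matrix.mulVec, dotProduct]
    simp [mul_comm, Finset.mul_sum]
  have hne : (Metric.sphere (0 : EuclideanSpace ℝ V) 1).Nonempty :=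
    NormedSpace.sphere_nonempty.2 zero_le_one
  obtain ⟨z, hz, hmax⟩ := (isCompact_sphere (0 : EuclideanSpace ℝ V) 1).exists_isMaxOn hne
    T.reApplyInnerSelf_continuous.continuousOn
  -- Entrywise absolute values keep the norm and do not decrease the quadratic form, so they give
  -- another maximiser on the sphere, hence an eigenvector.
  set x : EuclideanSpace ℝ V := WithLp.toLp 2 fun i => |z i| with hx
  have hxz : ‖x‖ = ‖z‖ := by simp [EuclideanSpace.norm_eq, hx]
  have hz1 : ‖z‖ = 1 := by simpa using hz
  have hle : T.reApplyInnerSelf z ≤ T.reApplyInnerSelf x := by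
    rw [hform, hform]
    refine Finset.sum_le_sum fun i _ => Finset.sum_le_sum fun j _ => ?_
    simp only [hx]
    calc M i j * z j * z i ≤ |M i j * z j * z i| := le_abs_self _
      _ = M i j * |z j| * |z i| := by rw [abs_mul, abs_mul, abs_of_nonneg (hM i j)]
  have hx0 : x ≠ 0 := by
    rw [← norm_ne_zero_iff, hxz, hz1]; exact one_ne_zero
  have hmax' : IsMaxOn T.reApplyInnerSelf (Metric.sphere 0 ‖x‖) x := by
    rw [hxz, hz1]
    exact fun y hy => (hmax hy).trans hle
  have hev := (hsa.hasEigenvector_of_isMaxOn hx0 hmax').apply_eq_smul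
  refine ⟨⨆ y : {y : EuclideanSpace ℝ V // y ≠ 0}, T.rayleighQuotient y, fun i => |z i|,
    fun v => abs_nonneg _, ?_, ?_⟩
  · intro h0
    exact hx0 (by rw [hx, h0]; rfl)
  · have := congrArg WithLp.ofLp hev
    rw [ContinuousLinearMap.coe_coe, hT, Matrix.ofLp_toEuclideanCLM] at this
    exact this

theorem dotProduct_mulVec_symm (M : Matrix V V ℝ) (hs : M.IsSymm) (x y : V → ℝ) :
    x ⬝ᵥ (M *ᵥ y) = y ⬝ᵥ (M *ᵥ x) := by
  rw [Matrix.dotProduct_mulVec, ← Matrix.mulVec_transpose, hs.eq, dotProduct_comm]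

/-- The eigenvalue of a positive eigenvector of a symmetric nonnegative matrix is its spectral
radius. -/
theorem spectralRadius_eq_of_pos_eigenvector [Nonempty V] [DecidableEq V] (M : Matrix V V ℝ)
    (hs : M.IsSymm) (hM : ∀ i j, 0 ≤ M i j) (ρ : ℝ) (x : V → ℝ) (hx : ∀ v, 0 < x v)
    (hev : M *ᵥ x = ρ • x) : spectralRadius ℝ M = ENNReal.ofReal ρ := by
  obtain ⟨v₀⟩ := ‹Nonempty V›
  have hρ : 0 ≤ ρ := by
    have h1 : (M *ᵥ x) v₀ = ρ * x v₀ := by rw [hev]; rfl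
    have h2 : 0 ≤ (M *ᵥ x) v₀ := Finset.sum_nonneg fun j _ => mul_nonneg (hM _ _) (hx j).le
    rw [h1] at h2
    exact nonneg_of_mul_nonneg_left h2 (hx v₀)
  have hspec : ∀ μ : ℝ, μ ∈ spectrum ℝ M ↔ Module.End.HasEigenvalue (Matrix.toLin' M) μ := by
    intro μ
    rw [Module.End.hasEigenvalue_iff_mem_spectrum, Matrix.spectrum_toLin']
  rw [spectralRadius]
  apply le_antisymm
  · refine iSup₂_le fun μ hμ => ?_
    obtain ⟨z, hz⟩ := ((hspec μ).1 hμ).exists_hasEigenvector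
    have hz0 := hz.2
    have hzev : M *ᵥ z = μ • z := by simpa using hz.apply_eq_smul
    -- For any eigenvector `z`, `|μ| |z| ≤ M |z|` entrywise; pairing this with the positive `x`
    -- gives `|μ| ≤ ρ`.
    have habs : ∀ v, |μ| * |z v| ≤ (M *ᵥ fun i => |z i|) v := by
      intro v
      rw [← abs_mul]
      have : μ * z v = (M *ᵥ z) v := by rw [hzev]; rfl
      rw [this, Matrix.mulVec, dotProduct]
      refine (Finset.abs_sum_le_sum_abs _ _).trans (le_of_eq ?_)
      rw [Matrix.mulVec, dotProduct]
      exact Finset.sum_congr rfl fun j _ => by rw [abs_mul, abs_of_nonneg (hM _ _)]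
    have hpos : 0 < ∑ v, x v * |z v| := by
      obtain ⟨w, hw⟩ := Function.ne_iff.1 hz0
      exact Finset.sum_pos' (fun v _ => mul_nonneg (hx v).le (abs_nonneg _))
        ⟨w, Finset.mem_univ _, mul_pos (hx w) (abs_pos.2 hw)⟩
    have hle : |μ| * ∑ v, x v * |z v| ≤ ρ * ∑ v, x v * |z v| := by
      calc |μ| * ∑ v, x v * |z v| = ∑ v, x v * (|μ| * |z v|) := by
            rw [Finset.mul_sum]; exact Finset.sum_congr rfl fun v _ => by ring
        _ ≤ x ⬝ᵥ (M *ᵥ fun i => |z i|) :=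
            Finset.sum_le_sum fun v _ => mul_le_mul_of_nonneg_left (habs v) (hx v).le
        _ = (fun i => |z i|) ⬝ᵥ (M *ᵥ x) := dotProduct_mulVec_symm M hs _ _
        _ = ρ * ∑ v, x v * |z v| := by
            rw [hev, dotProduct, Finset.mul_sum]
            exact Finset.sum_congr rfl fun v _ => by simp; ring
    have := le_of_mul_le_mul_right hle hpos
    have h2 : (‖μ‖₊ : ℝ≥0∞) = ENNReal.ofReal |μ| := by
      rw [← Real.norm_eq_abs, ofReal_norm, enorm_eq_nnnorm]
    rw [h2]
    exact ENNReal.ofReal_le_ofReal this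
  · have hmem : ρ ∈ spectrum ℝ M := by
      rw [hspec]
      refine Module.End.hasEigenvalue_of_hasEigenvector (x := x)
        ⟨Module.End.mem_eigenspace_iff.2 (by simpa using hev), fun h => ?_⟩
      exact (hx v₀).ne' (congrFun h v₀)
    refine le_trans (le_of_eq ?_) (le_iSup₂ (f := fun k (_ : k ∈ spectrum ℝ M) => (‖k‖₊ : ℝ≥0∞)) ρ hmem)
    rw [← abs_of_nonneg hρ, ← Real.norm_eq_abs, ofReal_norm, enorm_eq_nnnorm, Real.norm_eq_abs,
      abs_of_nonneg hρ]

end Perron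

/-! ### Perron vectors and test vectors for `A_α`. -/

section AlphaMatrix

variable {V : Type*} [Fintype V] [DecidableEq V]

open Classical in
theorem alphaMatrix_apply_eq (α : ℝ) (G : SimpleGraph V) (i j : V) :
    alphaMatrix α G i j = (if i = j then α * G.degree i else 0) +
      (1 - α) * (if G.Adj i j then 1 else 0) := by
  simp [alphaMatrix, SimpleGraph.degMatrix, Matrix.diagonal_apply, SimpleGraph.adjMatrix_apply]

theorem alphaMatrix_isSymm (α : ℝ) (G : SimpleGraph V) : (alphaMatrix α G).IsSymm := by
  ext i j
  rw [Matrix.transpose_apply, alphaMatrix_apply_eq, alphaMatrix_apply_eq]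
  by_cases h : i = j
  · subst h; rfl
  · by_cases ha : G.Adj i j
    · simp [h, Ne.symm h, ha, ha.symm]
    · have ha' : ¬ G.Adj j i := fun h' => ha h'.symm
      simp [h, Ne.symm h, ha, ha']

theorem alphaMatrix_nonneg {α : ℝ} (hα0 : 0 ≤ α) (hα1 : α ≤ 1) (G : SimpleGraph V) (i j : V) :
    0 ≤ alphaMatrix α G i j := by
  rw [alphaMatrix_apply_eq]
  have : 0 ≤ 1 - α := by linarith
  positivity

-- Distributing the degree over the edges makes each row a sum of edge contributions, so the pieces
-- attached to a vertex can be treated separately.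
open Classical in
theorem alphaMatrix_mulVec (α : ℝ) (G : SimpleGraph V) (x : V → ℝ) (v : V) :
    (alphaMatrix α G *ᵥ x) v = ∑ u, if G.Adj v u then α * x v + (1 - α) * x u else 0 := by
  have hdeg : (G.degree v : ℝ) = ∑ j : V, if G.Adj v j then 1 else 0 := G.degree_eq_sum_if_adj v
  simp only [Matrix.mulVec, dotProduct, alphaMatrix_apply_eq, add_mul, Finset.sum_add_distrib,
    ite_mul, zero_mul, Finset.sum_ite_eq, Finset.mem_univ, if_true]
  rw [hdeg, Finset.mul_sum, Finset.sum_mul, ← Finset.sum_add_distrib]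
  refine Finset.sum_congr rfl fun u _ => ?_
  split_ifs <;> ring

/-- A connected graph has a positive eigenvector for its `α`-spectral radius. -/
theorem exists_pos_eigenvector {α : ℝ} (hα0 : 0 ≤ α) (hα1 : α < 1) (G : SimpleGraph V)
    (hG : G.Connected) : ∃ (ρ : ℝ) (x : V → ℝ), (∀ v, 0 < x v) ∧
      alphaMatrix α G *ᵥ x = ρ • x ∧ alphaSpectralRadius α G = ENNReal.ofReal ρ := by
  classical
  have : Nonempty V := hG.nonempty
  obtain ⟨ρ, x, hx, hx0, hev⟩ := exists_nonneg_eigenvector (alphaMatrix α G)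
    (alphaMatrix_isSymm α G) (alphaMatrix_nonneg hα0 hα1.le G)
  -- At a zero of `x` the row is a vanishing sum of nonnegative terms, and `1 - α > 0` forces the
  -- neighbours to vanish; connectedness then spreads the zero everywhere.
  have hstep : ∀ v u, G.Adj v u → x v = 0 → x u = 0 := by
    intro v u hvu hv
    have h1 : (alphaMatrix α G *ᵥ x) v = 0 := by rw [hev]; simp [hv]
    rw [alphaMatrix_mulVec, Finset.sum_eq_zero_iff_of_nonneg] at h1
    · have h2 := h1 u (Finset.mem_univ u)
      rw [if_pos hvu, hv, mul_zero, zero_add] at h2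
      exact (mul_eq_zero.1 h2).resolve_left (by linarith)
    · intro w _
      have : 0 ≤ 1 - α := by linarith
      split_ifs
      · have := hx v; have := hx w; positivity
      · exact le_rfl
  have hwalk : ∀ v u, G.Walk v u → x v = 0 → x u = 0 := by
    intro v u p
    induction p with
    | nil => exact id
    | cons h _ ih => exact fun hv => ih (hstep _ _ h hv)
  have hpos : ∀ v, 0 < x v := by
    intro v
    refine (hx v).lt_of_ne fun h0 => hx0 ?_
    ext u
    obtain ⟨p⟩ := hG.preconnected v u
    exact hwalk v u p h0.symm
  exact ⟨ρ, x, hpos, hev, spectralRadius_eq_of_pos_eigenvector _ (alphaMatrix_isSymm α G)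
    (alphaMatrix_nonneg hα0 hα1.le G) ρ x hpos hev⟩

/-- A nonnegative strict subeigenvector for `ρ` shows that the `α`-spectral radius exceeds `ρ`. -/
theorem ofReal_lt_alphaSpectralRadius {α : ℝ} (hα0 : 0 ≤ α) (hα1 : α < 1) (G : SimpleGraph V)
    (hG : G.Connected) (ρ : ℝ) (hρ : 0 ≤ ρ) (y : V → ℝ) (hy : ∀ v, 0 ≤ y v)
    (hle : ∀ v, ρ * y v ≤ (alphaMatrix α G *ᵥ y) v)
    (hlt : ∃ v, ρ * y v < (alphaMatrix α G *ᵥ y) v) :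
    ENNReal.ofReal ρ < alphaSpectralRadius α G := by
  obtain ⟨μ, z, hz, hev, hμ⟩ := exists_pos_eigenvector hα0 hα1 G hG
  rw [hμ, ENNReal.ofReal_lt_ofReal_iff_of_nonneg hρ]
  obtain ⟨w, hw⟩ := hlt
  have h1 : ρ * ∑ v, z v * y v < μ * ∑ v, z v * y v := by
    calc ρ * ∑ v, z v * y v = ∑ v, z v * (ρ * y v) := by
          rw [Finset.mul_sum]; exact Finset.sum_congr rfl fun v _ => by ring
      _ < z ⬝ᵥ (alphaMatrix α G *ᵥ y) :=
          Finset.sum_lt_sum (fun v _ => mul_le_mul_of_nonneg_left (hle v) (hz v).le)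
            ⟨w, Finset.mem_univ _, mul_lt_mul_of_pos_left hw (hz w)⟩
      _ = y ⬝ᵥ (alphaMatrix α G *ᵥ z) := dotProduct_mulVec_symm _ (alphaMatrix_isSymm α G) _ _
      _ = μ * ∑ v, z v * y v := by
          rw [hev, dotProduct, Finset.mul_sum]
          exact Finset.sum_congr rfl fun v _ => by simp; ring
  have h2 : 0 ≤ ∑ v, z v * y v := Finset.sum_nonneg fun v _ => mul_nonneg (hz v).le (hy v)
  exact lt_of_mul_lt_mul_right h1 h2

theorem alphaSpectralRadius_congr {W : Type*} [Fintype W] [DecidableEq W] (α : ℝ)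
    {G : SimpleGraph V} {H : SimpleGraph W} (e : G ≃g H) :
    alphaSpectralRadius α G = alphaSpectralRadius α H := by
  have h : Matrix.reindexAlgEquiv ℝ ℝ e.toEquiv (alphaMatrix α G) = alphaMatrix α H := by
    ext i j
    classical
    have hd : ∀ i, G.degree (e.symm i) = H.degree i := fun i => e.symm.degree_eq i
    have ha : ∀ i j, G.Adj (e.symm i) (e.symm j) ↔ H.Adj i j := fun i j => e.symm.map_adj_iff
    rw [alphaMatrix_apply_eq]
    change alphaMatrix α G (e.symm i) (e.symm j) = _
    rw [alphaMatrix_apply_eq]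
    simp [hd, ha]
  rw [alphaSpectralRadius, alphaSpectralRadius, spectralRadius, spectralRadius, ← h,
    AlgEquiv.spectrum_eq]

end AlphaMatrix

/-! ### Eigenvalue equations along a pendant path. -/

section Path

/-- The ratio of consecutive entries of an `A_α`-eigenvector along a pendant path, counted from the
free end of the path; the initial value `-β` encodes the missing neighbour of the end vertex. -/
noncomputable def pathRatio (κ β : ℝ) : ℕ → ℝ
  | 0 => -β
  | m + 1 => 1 / (κ - pathRatio κ β m)

/-- The contribution of the first vertex of a pendant path to the row of its root, where `X 0` is
the root entry and `X (i + 1)` the entry of the `i`-th vertex of the path. -/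
noncomputable def pathStart (α : ℝ) (a : ℕ) (X : ℕ → ℝ) : ℝ :=
  if 0 < a then α * X 0 + (1 - α) * X 1 else 0

/-- The row of `A_α` at the `i`-th vertex of a pendant path of length `a`. -/
noncomputable def pathRow (α : ℝ) (a : ℕ) (X : ℕ → ℝ) (i : ℕ) : ℝ :=
  (α * X (i + 1) + (1 - α) * X i) +
    if i + 1 < a then α * X (i + 1) + (1 - α) * X (i + 2) else 0

theorem pathRow_succ (α : ℝ) (a : ℕ) (X : ℕ → ℝ) (i : ℕ) :
    pathRow α (a + 1) X (i + 1) = pathRow α a (fun j => X (j + 1)) i := by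
  simp [pathRow]

theorem pathRow_zero (α : ℝ) (a : ℕ) (X : ℕ → ℝ) :
    pathRow α (a + 1) X 0 = (α * X 1 + (1 - α) * X 0) + pathStart α a (fun j => X (j + 1)) := by
  simp [pathRow, pathStart]

variable {α ρ κ β : ℝ}

/-- Divided by `1 - α`, the row of a degree-two vertex reads `κ X₁ = X₀ + X₂`. Peeling off the root,
induction gives `X₂ = τ_a X₁`, hence `X₀ = (κ - τ_a) X₁`, and positivity of the entries makes each
denominator positive. -/
theorem pathStart_eq_of_pathRow_eq (hα1 : α < 1) (hκ : (1 - α) * κ = ρ - 2 * α)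
    (hβ : (1 - α) * β = α) (a : ℕ) (X : ℕ → ℝ) (hX : ∀ i ≤ a, 0 < X i)
    (hrow : ∀ i < a, pathRow α a X i = ρ * X (i + 1)) :
    pathStart α a X = (1 - α) * (β + pathRatio κ β a) * X 0 ∧
      ∀ j < a, 0 < κ - pathRatio κ β j := by
  induction a generalizing X with
  | zero => simp [pathStart, pathRatio]
  | succ a ih =>
    have h1 : 0 < 1 - α := by linarith
    obtain ⟨hs, hj⟩ := ih (fun j => X (j + 1)) (fun i hi => hX _ (by omega)) (fun i hi => by
      rw [← pathRow_succ]; exact hrow (i + 1) (by omega))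
    have h0 := hrow 0 (by omega)
    rw [pathRow_zero, hs] at h0
    have hX0 : X 0 = (κ - pathRatio κ β a) * X 1 := by
      have : (1 - α) * (X 0 - (κ - pathRatio κ β a) * X 1) = 0 := by
        simp only [zero_add] at h0
        linear_combination h0 - X 1 * hκ - X 1 * hβ
      linarith [(mul_eq_zero.1 this).resolve_left h1.ne']
    have hp0 := hX 0 (by omega)
    have hp1 := hX 1 (by omega)
    have hpos : 0 < κ - pathRatio κ β a := by
      rw [hX0] at hp0
      exact pos_of_mul_pos_left hp0 hp1.le
    refine ⟨?_, fun j hja => ?_⟩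
    · simp only [pathStart, pathRatio, Nat.succ_pos, if_true]
      rw [hX0]
      field_simp
      linear_combination (-(κ - pathRatio κ β a)) * hβ
    · rcases Nat.lt_succ_iff_lt_or_eq.1 hja with h | h
      · exact hj j h
      · rw [h]; exact hpos

/-- Converse of the elimination: positive denominators allow the path to be filled in from any
nonnegative root value by multiplying by successive ratios. -/
theorem exists_pathRow_eq (hκ : (1 - α) * κ = ρ - 2 * α)
    (hβ : (1 - α) * β = α) (a : ℕ) (hpos : ∀ j < a, 0 < κ - pathRatio κ β j) (r : ℝ)
    (hr : 0 ≤ r) :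
    ∃ X : ℕ → ℝ, X 0 = r ∧ (∀ i, 0 ≤ X i) ∧ (∀ i < a, pathRow α a X i = ρ * X (i + 1)) ∧
      pathStart α a X = (1 - α) * (β + pathRatio κ β a) * r := by
  induction a generalizing r with
  | zero => exact ⟨fun _ => r, rfl, fun _ => hr, by simp, by simp [pathStart, pathRatio]⟩
  | succ a ih =>
    have hp := hpos a (by omega)
    obtain ⟨X, hX0, hXn, hrow, hst⟩ := ih (fun j hj => hpos j (by omega))
      (r * pathRatio κ β (a + 1)) (by rw [pathRatio]; positivity)
    refine ⟨fun i => Nat.casesOn i r X, rfl, ?_, ?_, ?_⟩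
    · rintro (_ | i)
      · exact hr
      · exact hXn i
    · rintro (_ | i) hi
      · rw [pathRow_zero]
        change (α * X 0 + (1 - α) * r) + pathStart α a X = ρ * X 0
        rw [hst, hX0, pathRatio]
        field_simp
        linear_combination r * hκ + r * hβ
      · rw [pathRow_succ]
        exact hrow i (by omega)
    · rw [pathStart, if_pos a.succ_pos]
      change α * r + (1 - α) * X 0 = _
      rw [hX0]
      linear_combination (-r) * hβ

end Path

/-! ### Adjacency and matrix rows of the attached graphs. -/

section Attach

theorem thetaBase_adj (x y : Fin 4) :
    thetaBase.Adj x y ↔ x ≠ y ∧ ¬(x = 0 ∧ y = 2) ∧ ¬(x = 2 ∧ y = 0) := by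
  simp [thetaBase, SimpleGraph.deleteEdges_adj]

variable {s a b : ℕ} (u v w : Fin 4)

theorem attach_adj_core (x y : Fin 4) :
    (attach u v w s a b).Adj (.inl x) (.inl y) ↔ thetaBase.Adj x y := by
  simp only [attach, SimpleGraph.fromRel_adj, attachRel, thetaBase_adj, ne_eq, Sum.inl.injEq]
  tauto

theorem attach_adj_core_pendant (x : Fin 4) (i : Fin s) :
    (attach u v w s a b).Adj (.inl x) (.inr (.inl i)) ↔ x = u := by
  simp [attach, attachRel]

theorem attach_adj_core_left (x : Fin 4) (i : Fin a) :
    (attach u v w s a b).Adj (.inl x) (.inr (.inr (.inl i))) ↔ x = v ∧ i.val = 0 := by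
  simp [attach, attachRel]

theorem attach_adj_core_right (x : Fin 4) (i : Fin b) :
    (attach u v w s a b).Adj (.inl x) (.inr (.inr (.inr i))) ↔ x = w ∧ i.val = 0 := by
  simp [attach, attachRel]

theorem attach_adj_left (i j : Fin a) :
    (attach u v w s a b).Adj (.inr (.inr (.inl i))) (.inr (.inr (.inl j))) ↔
      i.val + 1 = j.val ∨ j.val + 1 = i.val := by
  simp only [attach, SimpleGraph.fromRel_adj, attachRel, ne_eq, Sum.inr.injEq, Sum.inl.injEq,
    Fin.ext_iff]
  omega

theorem attach_adj_right (i j : Fin b) :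
    (attach u v w s a b).Adj (.inr (.inr (.inr i))) (.inr (.inr (.inr j))) ↔
      i.val + 1 = j.val ∨ j.val + 1 = i.val := by
  simp only [attach, SimpleGraph.fromRel_adj, attachRel, ne_eq, Sum.inr.injEq, Fin.ext_iff]
  omega

theorem attach_not_adj_pendant_pendant (i j : Fin s) :
    ¬ (attach u v w s a b).Adj (.inr (.inl i)) (.inr (.inl j)) := by
  simp [attach, attachRel]

theorem attach_not_adj_pendant_left (i : Fin s) (j : Fin a) :
    ¬ (attach u v w s a b).Adj (.inr (.inl i)) (.inr (.inr (.inl j))) := by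
  simp [attach, attachRel]

theorem attach_not_adj_pendant_right (i : Fin s) (j : Fin b) :
    ¬ (attach u v w s a b).Adj (.inr (.inl i)) (.inr (.inr (.inr j))) := by
  simp [attach, attachRel]

theorem attach_not_adj_left_right (i : Fin a) (j : Fin b) :
    ¬ (attach u v w s a b).Adj (.inr (.inr (.inl i))) (.inr (.inr (.inr j))) := by
  simp [attach, attachRel]

theorem sum_ite_val_eq_zero (a : ℕ) (f : ℕ → ℝ) :
    (∑ j : Fin a, if j.val = 0 then f j else 0) = if 0 < a then f 0 else 0 := by
  rcases a with _ | a
  · simp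
  · simp

theorem sum_ite_val_neighbors (a i : ℕ) (hi : i < a) (f : ℕ → ℝ) :
    (∑ j : Fin a, if i + 1 = j.val ∨ j.val + 1 = i then f j else 0) =
      (if i = 0 then 0 else f (i - 1)) + if i + 1 < a then f (i + 1) else 0 := by
  have h1 : ∀ j : Fin a, (if i + 1 = j.val ∨ j.val + 1 = i then f j else 0) =
      (if j.val + 1 = i then f j else 0) + (if i + 1 = j.val then f j else 0) := by
    intro j
    by_cases h1 : i + 1 = j.val <;> by_cases h2 : j.val + 1 = i <;> simp [h1, h2]
    omega
  rw [Finset.sum_congr rfl fun j _ => h1 j, Finset.sum_add_distrib]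
  congr 1
  · by_cases h : i = 0
    · simp [h]
    · rw [Finset.sum_eq_single ⟨i - 1, by omega⟩]
      · simp [h, Nat.sub_add_cancel (Nat.pos_of_ne_zero h)]
      · intro j _ hj
        rw [if_neg]
        intro h'
        exact hj (Fin.ext (by simp; omega))
      · simp
  · by_cases h : i + 1 < a
    · rw [Finset.sum_eq_single ⟨i + 1, h⟩]
      · simp [h]
      · intro j _ hj
        rw [if_neg]
        intro h'
        exact hj (Fin.ext h'.symm)
      · simp
    · rw [if_neg h]
      refine Finset.sum_eq_zero fun j _ => ?_
      rw [if_neg]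
      have := j.2
      omega

variable {α : ℝ} (y : AttachVertex s a b → ℝ) (X Z : ℕ → ℝ)

-- `X` and `Z` list the entries of a path with its root at index `0`, hence the shift: path vertex
-- `i` is entry `i + 1`.
open Classical in
theorem attach_row_core (k : Fin 4) (hX0 : X 0 = y (.inl v))
    (hX : ∀ i : Fin a, X (i + 1) = y (.inr (.inr (.inl i)))) (hZ0 : Z 0 = y (.inl w))
    (hZ : ∀ i : Fin b, Z (i + 1) = y (.inr (.inr (.inr i)))) :
    (alphaMatrix α (attach u v w s a b) *ᵥ y) (.inl k) =
      (∑ l : Fin 4, if thetaBase.Adj k l then α * y (.inl k) + (1 - α) * y (.inl l) else 0) +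
      (if k = u then ∑ i : Fin s, (α * y (.inl k) + (1 - α) * y (.inr (.inl i))) else 0) +
      (if k = v then pathStart α a X else 0) + (if k = w then pathStart α b Z else 0) := by
  rw [alphaMatrix_mulVec]
  simp only [Fintype.sum_sum_type, attach_adj_core, attach_adj_core_pendant,
    attach_adj_core_left, attach_adj_core_right]
  rw [← add_assoc, ← add_assoc]
  congr 1
  · congr 1
    · congr 1
      split_ifs <;> simp
    · by_cases h : k = v
      · subst h
        simp only [true_and, if_true, pathStart, ← hX]
        rw [sum_ite_val_eq_zero a (fun j => α * y (.inl k) + (1 - α) * X (j + 1)), hX0]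
      · simp [h]
  · by_cases h : k = w
    · subst h
      simp only [true_and, if_true, pathStart, ← hZ]
      rw [sum_ite_val_eq_zero b (fun j => α * y (.inl k) + (1 - α) * Z (j + 1)), hZ0]
    · simp [h]

theorem attach_row_pendant (i : Fin s) :
    (alphaMatrix α (attach u v w s a b) *ᵥ y) (.inr (.inl i)) =
      α * y (.inr (.inl i)) + (1 - α) * y (.inl u) := by
  classical
  rw [alphaMatrix_mulVec]
  simp only [Fintype.sum_sum_type, SimpleGraph.adj_comm _ (Sum.inr (Sum.inl i)) (Sum.inl _),
    attach_adj_core_pendant, attach_not_adj_pendant_pendant, attach_not_adj_pendant_left,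
    attach_not_adj_pendant_right]
  simp

theorem attach_row_left (i : Fin a) (hX0 : X 0 = y (.inl v))
    (hX : ∀ i : Fin a, X (i + 1) = y (.inr (.inr (.inl i)))) :
    (alphaMatrix α (attach u v w s a b) *ᵥ y) (.inr (.inr (.inl i))) = pathRow α a X i := by
  classical
  have h1 : ∀ x j, (attach u v w s a b).Adj (.inr (.inr (.inl j))) (.inl x) ↔
      x = v ∧ j.val = 0 := fun x j => by rw [SimpleGraph.adj_comm, attach_adj_core_left]
  have h2 : ∀ i j, ¬(attach u v w s a b).Adj (.inr (.inr (.inl i))) (.inr (.inl j)) :=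
    fun i j h => attach_not_adj_pendant_left u v w _ _ h.symm
  rw [alphaMatrix_mulVec]
  simp only [Fintype.sum_sum_type, h1, h2, attach_adj_left, attach_not_adj_left_right, if_false,
    Finset.sum_const_zero, add_zero, zero_add, ← hX]
  rw [sum_ite_val_neighbors a i i.2 (fun j => α * X (i + 1) + (1 - α) * X (j + 1)), pathRow,
    ← add_assoc]
  congr 1
  by_cases h : i.val = 0
  · simp [h, hX0]
  · simp [h, Nat.sub_add_cancel (Nat.pos_of_ne_zero h)]

theorem attach_row_right (i : Fin b) (hZ0 : Z 0 = y (.inl w))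
    (hZ : ∀ i : Fin b, Z (i + 1) = y (.inr (.inr (.inr i)))) :
    (alphaMatrix α (attach u v w s a b) *ᵥ y) (.inr (.inr (.inr i))) = pathRow α b Z i := by
  classical
  have h1 : ∀ x j, (attach u v w s a b).Adj (.inr (.inr (.inr j))) (.inl x) ↔
      x = w ∧ j.val = 0 := fun x j => by rw [SimpleGraph.adj_comm, attach_adj_core_right]
  have h2 : ∀ i j, ¬(attach u v w s a b).Adj (.inr (.inr (.inr i))) (.inr (.inl j)) :=
    fun i j h => attach_not_adj_pendant_right u v w _ _ h.symm
  have h3 : ∀ i j, ¬(attach u v w s a b).Adj (.inr (.inr (.inr i))) (.inr (.inr (.inl j))) :=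
    fun i j h => attach_not_adj_left_right u v w _ _ h.symm
  rw [alphaMatrix_mulVec]
  simp only [Fintype.sum_sum_type, h1, h2, h3, attach_adj_right, if_false,
    Finset.sum_const_zero, zero_add, ← hZ]
  rw [sum_ite_val_neighbors b i i.2 (fun j => α * Z (i + 1) + (1 - α) * Z (j + 1)), pathRow,
    ← add_assoc]
  congr 1
  by_cases h : i.val = 0
  · simp [h, hZ0]
  · simp [h, Nat.sub_add_cancel (Nat.pos_of_ne_zero h)]

end Attach

/-! ### The scalar inequalities behind the comparison. -/

section Scalar

/-- This is the criterion for keeping both path lengths, with `c = u - w`. Since `1 + 1/v = h/2 -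
1/w`, the excess of the product over `1` has the sign of `h u w - 2(2h - c)`. -/
theorem one_lt_of_le_left {h w v τ u : ℝ} (hw : 0 < w) (hv : 0 < v) (hτ : 0 < τ)
    (hh : h = 2 + 2 / w + 2 / v) (hu : u = h - 1 - τ) (huw : w < u)
    (hor : 2 ≤ w ∨ v * τ ≤ w) :
    1 < (1 + 1 / u + 1 / v) * (1 / h + 1 / (h - (u - w))) := by
  set W := 1 / w with hW
  set V := 1 / v with hV
  have hwW : w * W = 1 := by rw [hW]; field_simp
  have hvV : v * V = 1 := by rw [hV]; field_simp
  have hW0 : 0 < W := by positivity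
  have hV0 : 0 < V := by positivity
  have hh' : h = 2 + 2 * W + 2 * V := by rw [hh, hW, hV]; ring
  have hu0 : 0 < u := hw.trans huw
  have hh0 : 0 < h := by rw [hh']; positivity
  have hd : h - (u - w) = 1 + τ + w := by rw [hu]; ring
  have hd0 : 0 < 1 + τ + w := by positivity
  have hu' : u = 1 + 2 * W + 2 * V - τ := by rw [hu, hh']; ring
  have hexp : u * w = w + 2 + 2 * (w * V) - τ * w := by
    rw [hu']; linear_combination 2 * hwW
  -- After expanding `h w` and `u w`, this is exactly the positivity of `h u w - 2(2h - c)`.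
  have key1 : 2 * τ < 2 * (w * V) - τ * w + u * (w * V) := by
    rcases hor with h2 | h2
    · have h3 : w * w < u * w := mul_lt_mul_of_pos_right huw hw
      have h5 : 0 < 2 * (w * V) - τ * w := by nlinarith
      have h6 : τ < 2 * V := by
        have : τ * w < 2 * V * w := by linarith
        exact lt_of_mul_lt_mul_right this hw.le
      have h7 : 4 * V ≤ u * (w * V) := by
        have h8 : 4 ≤ u * w := by nlinarith
        nlinarith
      linarith
    · have h3 : τ ≤ w * V := by
        have := mul_le_mul_of_nonneg_right h2 hV0.le
        have h4 : v * τ * V = τ := by linear_combination τ * hvV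
        linarith
      have h4 : w * τ < u * (w * V) := mul_lt_mul huw h3 hτ hu0.le
      linarith
  have key2 : 2 * (h + (1 + τ + w)) < h * u * w := by
    have h1 : h * w = 2 * w + 2 + 2 * (w * V) := by rw [hh']; linear_combination 2 * hwW
    have h2 : h * u * w = u * (2 * w + 2 + 2 * (w * V)) := by rw [← h1]; ring
    have h3 : h = u + 1 + τ := by rw [hu]; ring
    rw [h2, h3]
    nlinarith
  have hprod : (1 + 1 / u + V) * (1 / h + 1 / (1 + τ + w)) - 1 =
      (h * u * w - 2 * (h + (1 + τ + w))) * (u - w) / (2 * u * w * h * (1 + τ + w)) := by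
    have h1 : V = h / 2 - 1 - W := by rw [hh']; ring
    rw [h1, hW]
    have h2 : τ = h - 1 - u := by rw [hu]; ring
    have h3 : 1 + τ + w = h - u + w := by rw [h2]; ring
    rw [h3] at hd0 ⊢
    field_simp
    ring
  rw [hd]
  have : 0 < (h * u * w - 2 * (h + (1 + τ + w))) * (u - w) / (2 * u * w * h * (1 + τ + w)) :=
    div_pos (mul_pos (by linarith) (by linarith)) (by positivity)
  linarith

/-- This is the criterion after moving one vertex from the first path to the second. It reduces to
`β = 0`, where `u'` and `v'` become `1/τ` and `r = h - 1 - 1/v`. -/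
theorem one_lt_of_lt_right {h w v τ β u' v' : ℝ} (hw : 0 < w) (hv : 0 < v) (hτ : 0 < τ)
    (hβ : 0 ≤ β) (hh : h = 2 + 2 / w + 2 / v) (hlt : w < v * τ)
    (hu' : u' = 1 / τ - β) (hu'0 : 0 < u') (hv' : v' = h - 1 - 1 / (v + β)) :
    0 < v' ∧ 1 < (1 + 1 / u' + 1 / v') * (1 / h + 1 / (1 + τ + w)) := by
  set W := 1 / w with hW
  set V := 1 / v with hV
  have hwW : w * W = 1 := by rw [hW]; field_simp
  have hvV : v * V = 1 := by rw [hV]; field_simp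
  have hW0 : 0 < W := by positivity
  have hV0 : 0 < V := by positivity
  have hh' : h = 2 + 2 * W + 2 * V := by rw [hh, hW, hV]; ring
  have hh0 : 0 < h := by rw [hh']; positivity
  have hwV : w * V < τ := by
    have := mul_lt_mul_of_pos_right hlt hV0
    have h4 : v * τ * V = τ := by linear_combination τ * hvV
    linarith
  have hVW : V < τ * W := by
    have := mul_lt_mul_of_pos_right hwV hW0
    have h4 : w * V * W = V := by linear_combination V * hwW
    linarith
  set r := h - 1 - V with hr
  have hr' : r = 1 + 2 * W + V := by rw [hr, hh']; ring
  have hr0 : 0 < r := by rw [hr']; positivity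
  have hVle : 1 / (v + β) ≤ V := one_div_le_one_div_of_le hv (by linarith)
  have hrv : r ≤ v' := by rw [hv']; linarith
  have hv'0 : 0 < v' := hr0.trans_le hrv
  refine ⟨hv'0, ?_⟩
  have hVr : V ≤ τ * r := by rw [hr']; nlinarith
  -- Passing from `0` to `β` raises `1/u'` by at least `β τ²` and lowers `1/v'` by at most `β τ²`,
  -- the latter because `1/v ≤ τ r`.
  have hT : τ + 1 / r ≤ 1 / u' + 1 / v' := by
    have h1 : 1 / u' - τ = β * τ / u' := by
      have : 1 = (u' + β) * τ := by rw [hu']; field_simp; ring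
      field_simp
      linarith
    have h2 : β * τ * τ ≤ β * τ / u' := by
      have h3 : τ ≤ 1 / u' := by
        rw [le_div_iff₀ hu'0, hu']
        have h4 : τ * (1 / τ - β) = 1 - τ * β := by field_simp
        have : 0 ≤ τ * β := by positivity
        linarith
      calc β * τ * τ ≤ β * τ * (1 / u') := by gcongr
        _ = β * τ / u' := by ring
    have h3 : 1 / r - 1 / v' = (v' - r) / (r * v') := by field_simp
    have h4 : v' - r = β * V * (1 / (v + β)) := by
      rw [hv', hr, hV]; field_simp; ring
    have h5 : (v' - r) / (r * v') ≤ β * τ * τ := by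
      have hb : v' - r ≤ β * V * V := by
        rw [h4]; gcongr
      have hrr : r * r ≤ r * v' := by gcongr
      have hnn : 0 ≤ v' - r := by linarith
      rw [div_le_iff₀ (by positivity)]
      calc v' - r ≤ β * V * V := hb
        _ ≤ β * (τ * r) * (τ * r) := by gcongr
        _ = β * τ * τ * (r * r) := by ring
        _ ≤ β * τ * τ * (r * v') := by gcongr
    linarith
  have hmain : 1 < (1 + (τ + 1 / r)) * (1 / h + 1 / (1 + τ + w)) := by
    have h1 : (1 + (τ + 1 / r)) * (1 / h + 1 / (1 + τ + w)) - 1 =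
        (((1 + τ) * r + 1) * (h + 1 + τ + w) - h * (1 + τ + w) * r) / (r * h * (1 + τ + w)) := by
      field_simp
      ring
    have h2 : h * w = 2 * w + 2 + 2 * (w * V) := by rw [hh']; linear_combination 2 * hwW
    have h3 : ((1 + τ) * r + 1) * (h + 1 + τ + w) - h * (1 + τ + w) * r =
        r * ((1 + τ) ^ 2 + (1 + τ) * w - h * w) + (h + 1 + τ + w) := by ring
    have h4 : h + 1 + τ + w = r + 2 + V + τ + w := by rw [hr]; ring
    have h5 : 0 < r * ((1 + τ) ^ 2 + (1 + τ) * w - h * w) + (h + 1 + τ + w) := by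
      have h6 : τ ^ 2 + τ * w - w - 1 < (1 + τ) ^ 2 + (1 + τ) * w - h * w := by
        rw [h2]; nlinarith
      have h7 := mul_lt_mul_of_pos_left h6 hr0
      have h8 : r * w = w + 2 + w * V := by rw [hr']; linear_combination 2 * hwW
      have h9 : r * (τ ^ 2 + τ * w - w - 1) = r * τ ^ 2 + τ * (r * w) - r * w - r := by ring
      rw [h9, h8] at h7
      have h10 : 0 < r * τ ^ 2 := by positivity
      have h11 : 0 < τ * w := by positivity
      have h12 : 0 < τ * (w * V) := by positivity
      linarith
    have h6 : 0 < (((1 + τ) * r + 1) * (h + 1 + τ + w) - h * (1 + τ + w) * r) /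
        (r * h * (1 + τ + w)) := by
      rw [h3]; exact div_pos h5 (by positivity)
    linarith
  refine hmain.trans_le ?_
  have : 0 < 1 / h + 1 / (1 + τ + w) := by positivity
  gcongr ?_ * _
  linarith

variable {κ β : ℝ}

/-- The map `t ↦ 1/(κ - t)` is increasing below `κ`, and the first step goes from `-β ≤ 0` to a
positive number. -/
theorem pathRatio_lt_succ (hβ : 0 ≤ β) (m : ℕ) (hpos : ∀ j ≤ m, 0 < κ - pathRatio κ β j) :
    pathRatio κ β m < pathRatio κ β (m + 1) := by
  induction m with
  | zero =>
    have := hpos 0 le_rfl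
    have h : 0 < pathRatio κ β 1 := by rw [pathRatio]; positivity
    rw [pathRatio]
    linarith
  | succ m ih =>
    have h1 := ih fun j hj => hpos j (by omega)
    have h2 := hpos (m + 1) le_rfl
    rw [pathRatio, pathRatio.eq_2 κ β (m + 1)]
    exact one_div_lt_one_div_of_lt h2 (by linarith)

theorem pathRatio_lt_one (hβ : 0 ≤ β) (hκ : 2 < κ) (m : ℕ) : pathRatio κ β m < 1 := by
  induction m with
  | zero => rw [pathRatio]; linarith
  | succ m ih =>
    rw [pathRatio, div_lt_one (by linarith)]
    linarith

/-- The increments of `1 / (κ - β - τ)` along the sequence of path ratios `τ` decrease. -/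
theorem one_div_sub_pathRatio_increment_lt (hβ : 0 ≤ β) (hκ : 2 < κ - β) (m : ℕ) :
    1 / (κ - β - pathRatio κ β (m + 2)) - 1 / (κ - β - pathRatio κ β (m + 1)) <
      1 / (κ - β - pathRatio κ β (m + 1)) - 1 / (κ - β - pathRatio κ β m) := by
  have hκ' : 2 < κ := by linarith
  have h0 := pathRatio_lt_one hβ hκ' m
  have h1 := pathRatio_lt_one hβ hκ' (m + 1)
  have h2 := pathRatio_lt_one hβ hκ' (m + 2)
  have hlt := pathRatio_lt_succ (κ := κ) hβ m fun j _ => by linarith [pathRatio_lt_one hβ hκ' j]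
  have e1 : pathRatio κ β (m + 1) * (κ - pathRatio κ β m) = 1 := by
    rw [pathRatio]; exact one_div_mul_cancel (by linarith)
  have e2 : pathRatio κ β (m + 2) * (κ - pathRatio κ β (m + 1)) = 1 := by
    rw [pathRatio.eq_2 κ β (m + 1)]; exact one_div_mul_cancel (by linarith)
  generalize pathRatio κ β m = p at *
  generalize pathRatio κ β (m + 1) = q at *
  generalize pathRatio κ β (m + 2) = t at *
  have hq : 0 < q := pos_of_mul_pos_left (e1 ▸ one_pos) (by linarith)
  have ht : 0 < t := pos_of_mul_pos_left (e2 ▸ one_pos) (by linarith)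
  have ha : 0 < κ - β - p := by linarith
  have hb : 0 < κ - β - q := by linarith
  have hc : 0 < κ - β - t := by linarith
  -- Subtracting `κ - q = 1/t` from `κ - p = 1/q` shows that each increment of the ratios is the
  -- previous one times `q t`.
  have hΔ : t - q = (q - p) * (q * t) := by
    linear_combination (-t) * e1 + q * e2
  -- The left side is at most `t`, since `q (κ - p) = 1`, and `t < 1 < κ - β - t`.
  have hk : q * t * (κ - β - p) < κ - β - t := by
    have h3 : q * (κ - β - p) ≤ 1 := by nlinarith
    nlinarith
  rw [div_sub_div _ _ hc.ne' hb.ne', div_sub_div _ _ hb.ne' ha.ne', div_lt_div_iff₀ (by positivity)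
    (by positivity)]
  have h5 : (q - p) * (κ - β - q) * (q * t * (κ - β - p)) < (q - p) * (κ - β - q) * (κ - β - t) :=
    mul_lt_mul_of_pos_left hk (mul_pos (by linarith) hb)
  calc (1 * (κ - β - q) - (κ - β - t) * 1) * ((κ - β - q) * (κ - β - p))
      = (t - q) * ((κ - β - q) * (κ - β - p)) := by ring
    _ = (q - p) * (κ - β - q) * (q * t * (κ - β - p)) := by rw [hΔ]; ring
    _ < (q - p) * (κ - β - q) * (κ - β - t) := h5
    _ = (1 * (κ - β - p) - (κ - β - q) * 1) * ((κ - β - t) * (κ - β - q)) := by ring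

/-- Strict concavity: the increment at `a` is smaller than the one at `b`, so balancing the two
indices raises the sum. -/
theorem one_div_sub_pathRatio_add_lt (hβ : 0 ≤ β) (hκ : 2 < κ - β) {a b : ℕ} (hab : b < a) :
    1 / (κ - β - pathRatio κ β (a + 1)) + 1 / (κ - β - pathRatio κ β b) <
      1 / (κ - β - pathRatio κ β a) + 1 / (κ - β - pathRatio κ β (b + 1)) := by
  have hanti : StrictAnti fun m => 1 / (κ - β - pathRatio κ β (m + 1)) -
      1 / (κ - β - pathRatio κ β m) :=
    strictAnti_nat_of_succ_lt fun m => one_div_sub_pathRatio_increment_lt hβ hκ m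
  have := hanti hab
  simp only at this
  linarith

end Scalar

/-! ### Diameter, connectedness and isomorphisms of the attached graphs. -/

section Diameter

variable {V : Type*} {G : SimpleGraph V}

theorem edist_map_le {W : Type*} {H : SimpleGraph W} (f : G →g H) (u v : V) :
    H.edist (f u) (f v) ≤ G.edist u v := by
  refine le_iInf fun p => ?_
  rw [← SimpleGraph.Walk.length_map f p]
  exact SimpleGraph.edist_le _

theorem edist_iso {W : Type*} {H : SimpleGraph W} (e : G ≃g H) (u v : V) :
    H.edist (e u) (e v) = G.edist u v := by
  refine le_antisymm (edist_map_le e.toHom u v) ?_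
  simpa using edist_map_le e.symm.toHom (e u) (e v)

theorem diam_eq_of_iso {W : Type*} {H : SimpleGraph W} (e : G ≃g H) : G.diam = H.diam := by
  rw [SimpleGraph.diam, SimpleGraph.diam, SimpleGraph.ediam_eq_iSup_iSup_edist,
    SimpleGraph.ediam_eq_iSup_iSup_edist]
  exact congrArg _ (e.toEquiv.iSup_congr fun u =>
    (e.toEquiv.iSup_congr (g := fun w => H.edist (e u) w) fun v => edist_iso e u v).symm)

theorem edist_le_of_chain (f : ℕ → V) (L : ℕ) (hf : ∀ i < L, G.Adj (f i) (f (i + 1)))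
    (i k : ℕ) (h : i + k ≤ L) : G.edist (f i) (f (i + k)) ≤ k := by
  induction k with
  | zero => simp
  | succ k ih =>
    have h1 := ih (by omega)
    have h2 : G.edist (f (i + k)) (f (i + k + 1)) = 1 :=
      SimpleGraph.edist_eq_one_iff_adj.2 (hf _ (by omega))
    calc G.edist (f i) (f (i + k + 1)) ≤ _ := SimpleGraph.edist_triangle (v := f (i + k))
      _ ≤ k + 1 := by rw [h2]; gcongr
      _ = ((k + 1 : ℕ) : ℕ∞) := by push_cast; rfl

theorem abs_sub_le_length (φ : V → ℤ) (hφ : ∀ u v, G.Adj u v → |φ u - φ v| ≤ 1) {u v : V}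
    (p : G.Walk u v) : |φ u - φ v| ≤ p.length := by
  induction p with
  | nil => simp
  | @cons u w v h p ih =>
    have h1 := hφ _ _ h
    have h2 := abs_sub_le (φ u) (φ w) (φ v)
    rw [SimpleGraph.Walk.length_cons]
    push_cast
    linarith

/-- A graph with a chain of length `L`, all of whose other vertices are adjacent to an interior
vertex of the chain, has diameter `L` if there is a Lipschitz function separating the ends. -/
theorem connected_and_diam_eq_of_chain (f : ℕ → V) (L : ℕ)
    (hf : ∀ i < L, G.Adj (f i) (f (i + 1)))
    (hoff : ∀ v, (∃ j ≤ L, v = f j) ∨ ∃ c, 1 ≤ c ∧ c + 1 ≤ L ∧ G.Adj (f c) v)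
    (φ : V → ℤ) (hφ : ∀ u v, G.Adj u v → |φ u - φ v| ≤ 1) (hφL : φ (f L) - φ (f 0) = L) :
    G.Connected ∧ G.diam = L := by
  have hchain : ∀ i j, i ≤ L → j ≤ L → G.edist (f i) (f j) ≤ (max i j - min i j : ℕ) := by
    have key : ∀ i j, i ≤ j → j ≤ L → G.edist (f i) (f j) ≤ (j - i : ℕ) := by
      intro i j hij hj
      obtain ⟨k, rfl⟩ := Nat.exists_eq_add_of_le hij
      rw [Nat.add_sub_cancel_left]
      exact edist_le_of_chain f L hf i k hj
    intro i j hi hj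
    rcases le_total i j with h | h
    · rw [max_eq_right h, min_eq_left h]; exact key i j h hj
    · rw [max_eq_left h, min_eq_right h, SimpleGraph.edist_comm]; exact key j i h hi
  -- Each vertex lies within `t ≤ 1` of chain index `c`, with `t ≤ c ≤ L - t`. These margins absorb
  -- the detours: `t + |c - c'| + t' ≤ L`.
  have hanchor : ∀ v, ∃ c t : ℕ, c ≤ L ∧ t ≤ c ∧ c + t ≤ L ∧ t ≤ 1 ∧ G.edist (f c) v ≤ t := by
    intro v
    rcases hoff v with ⟨j, hj, rfl⟩ | ⟨c, h1, h2, h3⟩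
    · exact ⟨j, 0, hj, by omega, by omega, by omega, by simp⟩
    · exact ⟨c, 1, by omega, h1, h2, le_rfl,
        by rw [SimpleGraph.edist_eq_one_iff_adj.2 h3]; simp⟩
  have hle : ∀ u v, G.edist u v ≤ L := by
    intro u v
    obtain ⟨c, t, hc, htc, hct, -, hd⟩ := hanchor u
    obtain ⟨c', t', hc', htc', hct', -, hd'⟩ := hanchor v
    calc G.edist u v ≤ G.edist u (f c) + G.edist (f c) v := SimpleGraph.edist_triangle
      _ ≤ G.edist u (f c) + (G.edist (f c) (f c') + G.edist (f c') v) := by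
          gcongr; exact SimpleGraph.edist_triangle
      _ ≤ (t : ℕ∞) + ((max c c' - min c c' : ℕ) + (t' : ℕ∞)) := by
          rw [SimpleGraph.edist_comm]
          gcongr
          exact hchain c c' hc hc'
      _ = ((t + ((max c c' - min c c') + t') : ℕ) : ℕ∞) := by push_cast; rfl
      _ ≤ L := by
          rw [Nat.cast_le]
          rcases le_total c c' with h | h
          · rw [max_eq_right h, min_eq_left h]; omega
          · rw [max_eq_left h, min_eq_right h]; omega
  have hediam : G.ediam ≤ L := SimpleGraph.ediam_le_of_edist_le hle
  have : Nonempty V := ⟨f 0⟩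
  have hne : G.ediam ≠ ⊤ := fun h => by rw [h] at hediam; simp at hediam
  have hconn := SimpleGraph.connected_of_ediam_ne_top hne
  refine ⟨hconn, le_antisymm ?_ ?_⟩
  · exact ENat.toNat_le_of_le_natCast hediam
  · refine le_trans ?_ (SimpleGraph.dist_le_diam hne (u := f L) (v := f 0))
    obtain ⟨p, hp⟩ := hconn.exists_walk_length_eq_dist (f L) (f 0)
    have := abs_sub_le_length φ hφ p
    rw [hφL, hp] at this
    have h2 : (L : ℤ) ≤ |(L : ℤ)| := le_abs_self _
    exact_mod_cast h2.trans this

/-- The path through the two pendant paths and `w₁, w₂, w₃`. -/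
def attachChain (s a b : ℕ) (j : ℕ) : AttachVertex s a b :=
  if h : j < a then .inr (.inr (.inl ⟨a - 1 - j, by omega⟩))
  else if j = a then .inl 0
  else if j = a + 1 then .inl 1
  -- Subtraction truncates, so `j = a + 2` passes this test when `b > 0`, whence the inner case; for
  -- `b = 0` it falls to the last branch.
  else if h : j - (a + 3) < b then
    if j = a + 2 then .inl 2 else .inr (.inr (.inr ⟨j - (a + 3), h⟩))
  else .inl 2

/-- The position of a vertex of `attach u 0 2 s a b` along `attachChain`. -/
def attachPosition (u : Fin 4) (s a b : ℕ) : AttachVertex s a b → ℤ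
  | .inl x => a + (![0, 1, 2, 1] : Fin 4 → ℤ) x
  | .inr (.inl _) => a + (![0, 1, 2, 1] : Fin 4 → ℤ) u
  | .inr (.inr (.inl i)) => a - 1 - i
  | .inr (.inr (.inr i)) => a + 3 + i

variable {s a b : ℕ}

theorem attachChain_left (i : Fin a) :
    attachChain s a b (a - 1 - i) = .inr (.inr (.inl i)) := by
  have := i.2
  rw [attachChain, dif_pos (by omega)]
  congr 4
  omega

theorem attachChain_zero : attachChain s a b a = .inl 0 := by simp [attachChain]

theorem attachChain_one : attachChain s a b (a + 1) = .inl 1 := by simp [attachChain]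

theorem attachChain_two : attachChain s a b (a + 2) = .inl 2 := by simp [attachChain]

theorem attachChain_right (i : Fin b) :
    attachChain s a b (a + 3 + i) = .inr (.inr (.inr i)) := by
  simp only [attachChain]
  rw [dif_neg (by omega), if_neg (by omega), if_neg (by omega), dif_pos (by omega),
    if_neg (by omega)]
  congr 4
  omega

theorem attachChain_adj (u : Fin 4) (j : ℕ) (hj : j < a + b + 2) :
    (attach u 0 2 s a b).Adj (attachChain s a b j) (attachChain s a b (j + 1)) := by
  rcases lt_or_ge j a with h | h
  · have h1 : attachChain s a b j = .inr (.inr (.inl ⟨a - 1 - j, by omega⟩)) := by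
      rw [← attachChain_left]; congr 1; simp; omega
    rw [h1]
    rcases Nat.lt_or_ge (j + 1) a with h' | h'
    · have h2 : attachChain s a b (j + 1) = .inr (.inr (.inl ⟨a - 1 - (j + 1), by omega⟩)) := by
        rw [← attachChain_left]; congr 1; simp; omega
      rw [h2, attach_adj_left]
      right; simp; omega
    · have h2 : j + 1 = a := by omega
      rw [h2, attachChain_zero, SimpleGraph.adj_comm, attach_adj_core_left]
      refine ⟨rfl, ?_⟩
      simp; omega
  · obtain ⟨k, rfl⟩ := Nat.exists_eq_add_of_le h
    match k with
    | 0 => rw [add_zero, attachChain_zero, attachChain_one, attach_adj_core, thetaBase_adj]; decide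
    | 1 =>
      rw [attachChain_one, attachChain_two, attach_adj_core, thetaBase_adj]; decide
    | 2 =>
      have hb : 0 < b := by omega
      have h2 : attachChain s a b (a + 2 + 1) = .inr (.inr (.inr ⟨0, hb⟩)) :=
        attachChain_right ⟨0, hb⟩
      rw [attachChain_two, h2, attach_adj_core_right]
      exact ⟨rfl, rfl⟩
    | k + 3 =>
      have h1 : attachChain s a b (a + (k + 3)) = .inr (.inr (.inr ⟨k, by omega⟩)) := by
        rw [← attachChain_right]; congr 1; simp; omega
      have h2 : attachChain s a b (a + (k + 3) + 1) = .inr (.inr (.inr ⟨k + 1, by omega⟩)) := by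
        rw [← attachChain_right]; congr 1; simp; omega
      rw [h1, h2, attach_adj_right]
      left; rfl

theorem abs_attachPosition_sub_le (u : Fin 4) (x y : AttachVertex s a b)
    (h : (attach u 0 2 s a b).Adj x y) :
    |attachPosition u s a b x - attachPosition u s a b y| ≤ 1 := by
  have key : ∀ x y, attachRel u 0 2 s a b x y →
      |attachPosition u s a b x - attachPosition u s a b y| ≤ 1 := by
    intro x y h
    rcases x with x | i | i | i <;> rcases y with y | j | j | j <;>
      simp only [attachRel] at h
    · simp only [attachPosition, add_sub_add_left_eq_sub]
      rw [thetaBase_adj] at h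
      revert h x y
      decide
    · subst h; simp [attachPosition]
    · obtain ⟨rfl, h⟩ := h; simp [attachPosition, h]
    · obtain ⟨rfl, h⟩ := h; simp [attachPosition, h]
    · simp only [attachPosition]; rw [abs_le]; omega
    · simp only [attachPosition]; rw [abs_le]; omega
  rw [attach, SimpleGraph.fromRel_adj] at h
  rcases h.2 with h | h
  · exact key x y h
  · rw [abs_sub_comm]; exact key y x h

/-- Pendant vertices must hang from an interior vertex of the chain. This always holds for `w₂`, but
`w₁` is an end of the chain when `a = 0`, hence the condition in `hu`. -/
theorem attach_connected_and_diam (u : Fin 4)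
    (hu : u = 1 ∨ u = 0 ∧ (1 ≤ a ∨ s = 0)) :
    (attach u 0 2 s a b).Connected ∧ (attach u 0 2 s a b).diam = a + b + 2 := by
  refine connected_and_diam_eq_of_chain (attachChain s a b) (a + b + 2)
    (fun i hi => attachChain_adj u i hi) ?_ (attachPosition u s a b)
    (abs_attachPosition_sub_le u) ?_
  · rintro (x | i | i | i)
    · match x with
      | 0 => exact .inl ⟨a, by omega, attachChain_zero.symm⟩
      | 1 => exact .inl ⟨a + 1, by omega, attachChain_one.symm⟩
      | 2 => exact .inl ⟨a + 2, by omega, attachChain_two.symm⟩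
      | 3 =>
        refine .inr ⟨a + 1, by omega, by omega, ?_⟩
        rw [attachChain_one, attach_adj_core, thetaBase_adj]; decide
    · right
      rcases hu with rfl | ⟨rfl, h | h⟩
      · refine ⟨a + 1, by omega, by omega, ?_⟩
        rw [attachChain_one, attach_adj_core_pendant]
      · refine ⟨a, by omega, by omega, ?_⟩
        rw [attachChain_zero, attach_adj_core_pendant]
      · subst h; exact i.elim0
    · exact .inl ⟨a - 1 - i, by omega, (attachChain_left i).symm⟩
    · exact .inl ⟨a + 3 + i, by omega, (attachChain_right i).symm⟩
  · have h0 : attachPosition u s a b (attachChain s a b 0) = 0 := by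
      rcases Nat.eq_zero_or_pos a with h | h
      · subst h; rw [attachChain_zero]; simp [attachPosition]
      · have := attachChain_left (s := s) (b := b) (⟨a - 1, by omega⟩ : Fin a)
        rw [show a - 1 - ((⟨a - 1, by omega⟩ : Fin a) : ℕ) = 0 by simp] at this
        rw [this]; simp only [attachPosition]; omega
    have h1 : attachPosition u s a b (attachChain s a b (a + b + 2)) = (a + b + 2 : ℕ) := by
      rcases Nat.eq_zero_or_pos b with h | h
      · subst h; rw [add_zero, attachChain_two]; simp [attachPosition]
      · have := attachChain_right (s := s) (a := a) (⟨b - 1, by omega⟩ : Fin b)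
        rw [show a + 3 + ((⟨b - 1, by omega⟩ : Fin b) : ℕ) = a + b + 2 by simp; omega] at this
        rw [this]; simp only [attachPosition]; omega
    rw [h0, h1, sub_zero]

/-- Swapping the two pendant paths. -/
def theta4SwapIso (a b : ℕ) : theta4 0 a b ≃g theta4 0 b a where
  toEquiv := Equiv.sumCongr (Equiv.swap 0 2)
    (Equiv.sumCongr (Equiv.refl _) (Equiv.sumComm _ _))
  map_rel_iff' := by
    rintro (x | i | i | i) (y | j | j | j) <;> try exact i.elim0
    all_goals try exact j.elim0
    all_goals
      simp only [theta4, attach, SimpleGraph.fromRel_adj, attachRel, Equiv.sumCongr_apply,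
        Sum.map_inl, Sum.map_inr, Equiv.sumComm_apply, Sum.swap_inl, Sum.swap_inr, thetaBase_adj]
    · revert x y
      simp only [ne_eq, Sum.inl.injEq]
      decide
    all_goals simp [Equiv.swap_apply_eq_iff]

/-- A pendant path of length one is a pendant edge. -/
def theta4PendantIso (s b : ℕ) : theta4 (s + 1) 0 b ≃g theta4 s 1 b where
  toEquiv := Equiv.sumCongr (Equiv.refl _)
    ((Equiv.sumCongr finSumFinEquiv.symm (Equiv.emptySum _ _)).trans (Equiv.sumAssoc _ _ _))
  map_rel_iff' := by
    rintro (x | i | i | i) (y | j | j | j) <;> try exact i.elim0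
    all_goals try exact j.elim0
    all_goals try obtain ⟨i | i, rfl⟩ := finSumFinEquiv.surjective i
    all_goals try obtain ⟨j | j, rfl⟩ := finSumFinEquiv.surjective j
    all_goals
      simp [theta4, attach, SimpleGraph.fromRel_adj, attachRel, -finSumFinEquiv_apply_left,
        -finSumFinEquiv_apply_right]

end Diameter

/-! ### From eigenvectors to scalar relations and back. -/

section Relations

variable {α ρ κ β : ℝ}

theorem sum_thetaBase (k : Fin 4) (f : Fin 4 → ℝ) :
    (open Classical in ∑ l : Fin 4, if thetaBase.Adj k l then f l else 0) =
      (![f 1 + f 3, f 0 + f 2 + f 3, f 1 + f 3, f 0 + f 1 + f 2] : Fin 4 → ℝ) k := by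
  fin_cases k <;> simp [Fin.sum_univ_four, thetaBase_adj]

/-- The scalar relations satisfied by the eigenvalue of a positive eigenvector of `Θ₄(s; a, b)`. -/
theorem theta4_relations (hα1 : α < 1) (hκ : (1 - α) * κ = ρ - 2 * α)
    (hβ : (1 - α) * β = α) (s a b : ℕ) (x : AttachVertex s a b → ℝ) (hx : ∀ v, 0 < x v)
    (hev : alphaMatrix α (theta4 s a b) *ᵥ x = ρ • x) :
    (∀ j < a, 0 < κ - pathRatio κ β j) ∧ (∀ j < b, 0 < κ - pathRatio κ β j) ∧
      (0 < s → 0 < κ + β) ∧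
      0 < κ - β - pathRatio κ β a - s * (β + pathRatio κ β 1) ∧
      0 < κ - β - pathRatio κ β b ∧
      κ - β - 1 = 2 / (κ - β - pathRatio κ β a - s * (β + pathRatio κ β 1)) +
        2 / (κ - β - pathRatio κ β b) := by
  have h1 : 0 < 1 - α := by linarith
  have hrow : ∀ v, (alphaMatrix α (theta4 s a b) *ᵥ x) v = ρ * x v := fun v => by rw [hev]; rfl
  rw [theta4] at hrow
  set X : ℕ → ℝ := fun i => Nat.casesOn i (x (.inl 0)) fun j =>
    if h : j < a then x (.inr (.inr (.inl ⟨j, h⟩))) else 0 with hXdef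
  set Z : ℕ → ℝ := fun i => Nat.casesOn i (x (.inl 2)) fun j =>
    if h : j < b then x (.inr (.inr (.inr ⟨j, h⟩))) else 0 with hZdef
  have hX0 : X 0 = x (.inl 0) := rfl
  have hZ0 : Z 0 = x (.inl 2) := rfl
  have hX : ∀ i : Fin a, X (i + 1) = x (.inr (.inr (.inl i))) := fun i => by simp [hXdef]
  have hZ : ∀ i : Fin b, Z (i + 1) = x (.inr (.inr (.inr i))) := fun i => by simp [hZdef]
  obtain ⟨hXs, hXj⟩ := pathStart_eq_of_pathRow_eq hα1 hκ hβ a X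
    (by
      rintro (_ | i) hi
      · exact hx _
      · rw [hX ⟨i, hi⟩]; exact hx _)
    (fun i hi => by
      rw [hX ⟨i, hi⟩, ← hrow, attach_row_left 0 0 2 x X ⟨i, hi⟩ hX0 hX])
  obtain ⟨hZs, hZj⟩ := pathStart_eq_of_pathRow_eq hα1 hκ hβ b Z
    (by
      rintro (_ | i) hi
      · exact hx _
      · rw [hZ ⟨i, hi⟩]; exact hx _)
    (fun i hi => by
      rw [hZ ⟨i, hi⟩, ← hrow, attach_row_right 0 0 2 x Z ⟨i, hi⟩ hZ0 hZ])
  have hpend : ∀ i : Fin s, x (.inl 0) = (κ + β) * x (.inr (.inl i)) := by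
    intro i
    have h := hrow (.inr (.inl i))
    rw [attach_row_pendant] at h
    have : (1 - α) * (x (.inl 0) - (κ + β) * x (.inr (.inl i))) = 0 := by
      linear_combination h - x (.inr (.inl i)) * hκ - x (.inr (.inl i)) * hβ
    linarith [(mul_eq_zero.1 this).resolve_left h1.ne']
  have hκβ : 0 < s → 0 < κ + β := fun hs => by
    have h := hpend ⟨0, hs⟩
    have h0 := hx (.inl 0)
    rw [h] at h0
    exact pos_of_mul_pos_left h0 (hx _).le
  have hsum : ∑ i : Fin s, (α * x (.inl 0) + (1 - α) * x (.inr (.inl i))) =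
      (1 - α) * (s * (β + pathRatio κ β 1)) * x (.inl 0) := by
    rw [Finset.sum_congr rfl fun i _ => show α * x (.inl 0) + (1 - α) * x (.inr (.inl i)) =
      (1 - α) * (β + pathRatio κ β 1) * x (.inl 0) from ?_]
    · simp; ring
    · have hp := hκβ (Fin.pos i)
      rw [hpend i, pathRatio, pathRatio, sub_neg_eq_add]
      field_simp
      linear_combination (-(κ + β) * x (.inr (.inl i))) * hβ
  have r0 := hrow (.inl 0)
  have r1 := hrow (.inl 1)
  have r2 := hrow (.inl 2)
  have r3 := hrow (.inl 3)
  rw [attach_row_core 0 0 2 x X Z _ hX0 hX hZ0 hZ, sum_thetaBase] at r0 r1 r2 r3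
  rw [hXs, hZs, hX0, hZ0, hsum] at r0
  rw [hXs, hZs, hX0, hZ0] at r2
  simp at r0 r1 r2 r3
  have p0 := hx (.inl 0)
  have p1 := hx (.inl 1)
  have p2 := hx (.inl 2)
  have p3 := hx (.inl 3)
  generalize x (.inl 0) = x0 at *
  generalize x (.inl 1) = x1 at *
  generalize x (.inl 2) = x2 at *
  generalize x (.inl 3) = x3 at *
  generalize hc : (s : ℝ) * (β + pathRatio κ β 1) = c at *
  have e0 : (κ - β - pathRatio κ β a - c) * x0 = x1 + x3 := by
    refine mul_left_cancel₀ h1.ne' ?_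
    linear_combination x0 * hκ - r0
  have e2 : (κ - β - pathRatio κ β b) * x2 = x1 + x3 := by
    refine mul_left_cancel₀ h1.ne' ?_
    linear_combination x2 * hκ - r2
  have e1 : (κ - β) * x1 = x0 + x2 + x3 := by
    refine mul_left_cancel₀ h1.ne' ?_
    linear_combination x1 * hκ - x1 * hβ - r1
  have e3 : (κ - β) * x3 = x0 + x1 + x2 := by
    refine mul_left_cancel₀ h1.ne' ?_
    linear_combination x3 * hκ - x3 * hβ - r3
  have hw : 0 < κ - β - pathRatio κ β a - c :=
    pos_of_mul_pos_left (e0 ▸ add_pos p1 p3) p0.le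
  have hv : 0 < κ - β - pathRatio κ β b :=
    pos_of_mul_pos_left (e2 ▸ add_pos p1 p3) p2.le
  have hk : 0 < κ - β := pos_of_mul_pos_left (e1 ▸ add_pos (add_pos p0 p2) p3) p1.le
  -- `w₂` and `w₄` are twins here: subtracting their rows leaves `(κ - β + 1)(x1 - x3) = 0` with a
  -- positive factor.
  have hx13 : x1 = x3 := by
    have : (κ - β + 1) * (x1 - x3) = 0 := by linear_combination e1 - e3
    linarith [(mul_eq_zero.1 this).resolve_left (by linarith)]
  subst hx13
  refine ⟨hXj, hZj, hκβ, hw, hv, ?_⟩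
  have f0 : x0 = 2 / (κ - β - pathRatio κ β a - c) * x1 := by
    field_simp; linarith
  have f2 : x2 = 2 / (κ - β - pathRatio κ β b) * x1 := by
    field_simp; linarith
  refine mul_right_cancel₀ p1.ne' ?_
  rw [add_mul, ← f0, ← f2]
  linarith

/-- The test vector solves all rows exactly except those of `w₂` and `w₄`. In both of these the
excess is `(1 - α)` times the sum of the four core entries minus `1`, and `hlt` says that this sum
exceeds `1`. -/
theorem lt_alphaSpectralRadius_theta5 (hα0 : 0 ≤ α) (hα1 : α < 1)
    (hκ : (1 - α) * κ = ρ - 2 * α) (hβ : (1 - α) * β = α) (hρ : 0 ≤ ρ) (s a b : ℕ)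
    (ha : ∀ j < a, 0 < κ - pathRatio κ β j) (hb : ∀ j < b, 0 < κ - pathRatio κ β j)
    (hs : 0 < s → 0 < κ + β)
    (hu : 0 < κ - β - pathRatio κ β a) (hv : 0 < κ - β - pathRatio κ β b)
    (hh : 0 < κ - β + 1) (hhc : 0 < κ - β + 1 - s * (β + pathRatio κ β 1))
    (hlt : 1 < (1 + 1 / (κ - β - pathRatio κ β a) + 1 / (κ - β - pathRatio κ β b)) *
      (1 / (κ - β + 1) + 1 / (κ - β + 1 - s * (β + pathRatio κ β 1)))) :
    ENNReal.ofReal ρ < alphaSpectralRadius α (theta5 s a b) := by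
  have h1 : 0 < 1 - α := by linarith
  set u := κ - β - pathRatio κ β a with hu'
  set v := κ - β - pathRatio κ β b with hv'
  set c := (s : ℝ) * (β + pathRatio κ β 1) with hc
  -- For an exact eigenvector, `(h - c) y1` and `h y3` both equal the sum of the core entries;
  -- normalising that sum to `1` gives these values.
  set y1 := 1 / (κ - β + 1 - c) with hy1
  set y3 := 1 / (κ - β + 1) with hy3
  have p1 : 0 < y1 := by positivity
  have p3 : 0 < y3 := by positivity
  have e1 : (κ - β + 1 - c) * y1 = 1 := by rw [hy1]; field_simp
  have e3 : (κ - β + 1) * y3 = 1 := by rw [hy3]; field_simp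
  set y0 := (y1 + y3) / u with hy0
  set y2 := (y1 + y3) / v with hy2
  have e0 : u * y0 = y1 + y3 := by rw [hy0]; field_simp
  have e2 : v * y2 = y1 + y3 := by rw [hy2]; field_simp
  have hgt : 1 < y1 + y3 + y0 + y2 := by
    refine hlt.trans_le (le_of_eq ?_)
    rw [hy0, hy2]; ring
  obtain ⟨X, hX0, hXn, hXr, hXs⟩ := exists_pathRow_eq hκ hβ a ha y0 (by positivity)
  obtain ⟨Z, hZ0, hZn, hZr, hZs⟩ := exists_pathRow_eq hκ hβ b hb y2 (by positivity)
  set y : AttachVertex s a b → ℝ := Sum.elim ![y0, y1, y2, y3]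
    (Sum.elim (fun _ => pathRatio κ β 1 * y1)
      (Sum.elim (fun i => X (i + 1)) fun i => Z (i + 1))) with hy
  have hX : ∀ i : Fin a, X (i + 1) = y (.inr (.inr (.inl i))) := fun i => rfl
  have hZ : ∀ i : Fin b, Z (i + 1) = y (.inr (.inr (.inr i))) := fun i => rfl
  have hp : 0 < s → (κ + β) * pathRatio κ β 1 = 1 := fun h => by
    have := hs h
    rw [pathRatio, pathRatio, sub_neg_eq_add]; field_simp
  have hcore := fun k => attach_row_core (α := α) 1 0 2 y X Z k hX0 hX hZ0 hZ
  have r0 : ρ * y (.inl 0) = (alphaMatrix α (theta5 s a b) *ᵥ y) (.inl 0) := by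
    rw [theta5, hcore, sum_thetaBase, hXs]
    simp [hy]
    rw [hu'] at e0
    linear_combination (1 - α) * e0 - y0 * hκ
  have r2 : ρ * y (.inl 2) = (alphaMatrix α (theta5 s a b) *ᵥ y) (.inl 2) := by
    rw [theta5, hcore, sum_thetaBase, hZs]
    simp [hy]
    rw [hv'] at e2
    linear_combination (1 - α) * e2 - y2 * hκ
  have r1 : ρ * y (.inl 1) < (alphaMatrix α (theta5 s a b) *ᵥ y) (.inl 1) := by
    have : (alphaMatrix α (theta5 s a b) *ᵥ y) (.inl 1) - ρ * y (.inl 1) =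
        (1 - α) * (y1 + y3 + y0 + y2 - 1) := by
      rw [theta5, hcore, sum_thetaBase]
      simp [hy]
      rw [hc] at e1
      linear_combination (-(1 - α)) * e1 + y1 * hκ - y1 * hβ - s * y1 * hβ
    have := mul_pos h1 (sub_pos.2 hgt)
    linarith
  have r3 : ρ * y (.inl 3) < (alphaMatrix α (theta5 s a b) *ᵥ y) (.inl 3) := by
    have : (alphaMatrix α (theta5 s a b) *ᵥ y) (.inl 3) - ρ * y (.inl 3) =
        (1 - α) * (y1 + y3 + y0 + y2 - 1) := by
      rw [theta5, hcore, sum_thetaBase]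
      simp [hy]
      linear_combination (-(1 - α)) * e3 + y3 * hκ - y3 * hβ
    have := mul_pos h1 (sub_pos.2 hgt)
    linarith
  refine ofReal_lt_alphaSpectralRadius hα0 hα1 _
    (attach_connected_and_diam 1 (.inl rfl)).1 ρ hρ y ?_ ?_ ⟨_, r1⟩
  · rintro (k | i | i | i)
    · fin_cases k <;> simp [hy] <;> positivity
    · have h2 := hs (Fin.pos i)
      have : 0 ≤ pathRatio κ β 1 := by
        rw [pathRatio, pathRatio, sub_neg_eq_add]; positivity
      simp only [hy, Sum.elim_inl, Sum.elim_inr]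
      positivity
    · exact hXn _
    · exact hZn _
  · rintro (k | i | i | i)
    · match k with
      | 0 => exact r0.le
      | 1 => exact r1.le
      | 2 => exact r2.le
      | 3 => exact r3.le
    · rw [attach_row_pendant]
      have h2 := hp (Fin.pos i)
      simp only [hy, Sum.elim_inl, Sum.elim_inr]
      simp
      refine le_of_eq ?_
      linear_combination (1 - α) * y1 * h2 - y1 * pathRatio κ β 1 * hκ -
        y1 * pathRatio κ β 1 * hβ
    · rw [attach_row_left 1 0 2 y X i hX0 hX, hXr i i.2, hX]
    · rw [attach_row_right 1 0 2 y Z i hZ0 hZ, hZr i i.2, hZ]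

end Relations

/-! ### Comparison of the two families. -/

/-- With at least one pendant edge, `Θ₅(s; a, b)` or `Θ₅(s; a - 1, b + 1)` has larger
`α`-spectral radius than `Θ₄(s; a, b)`. -/
theorem theta4_lt_theta5_of_pendant {α : ℝ} (hα0 : 0 ≤ α) (hα1 : α < 1) (s a b : ℕ)
    (hs : 0 < s) :
    alphaSpectralRadius α (theta4 s (a + 1) b) < alphaSpectralRadius α (theta5 s (a + 1) b) ∨
      alphaSpectralRadius α (theta4 s (a + 1) b) <
        alphaSpectralRadius α (theta5 s a (b + 1)) := by
  obtain ⟨ρ, x, hx, hev, hρ⟩ := exists_pos_eigenvector hα0 hα1 (theta4 s (a + 1) b)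
    (attach_connected_and_diam 0 (.inr ⟨rfl, .inl (by omega)⟩)).1
  have h1 : 0 < 1 - α := by linarith
  set κ := (ρ - 2 * α) / (1 - α) with hκd
  set β := α / (1 - α) with hβd
  have hκ : (1 - α) * κ = ρ - 2 * α := by rw [hκd]; field_simp
  have hβ : (1 - α) * β = α := by rw [hβd]; field_simp
  have hβ0 : 0 ≤ β := by positivity
  obtain ⟨ha, hb, hκβ, hw, hv, hchar⟩ := theta4_relations hα1 hκ hβ s (a + 1) b x hx hev
  have hκβ := hκβ hs
  have hk : 0 < κ - β - 1 := by rw [hchar]; positivity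
  have hρ0 : 0 ≤ ρ := by
    have : 0 < (1 - α) * κ := mul_pos h1 (by linarith)
    linarith
  have hτ1 : 0 < pathRatio κ β 1 := by
    rw [pathRatio, pathRatio, sub_neg_eq_add]; positivity
  have hc : 0 < (s : ℝ) * (β + pathRatio κ β 1) := by
    have : (0 : ℝ) < s := by exact_mod_cast hs
    positivity
  have hpa := ha a (by omega)
  have hτ : 0 < pathRatio κ β (a + 1) := by rw [pathRatio]; positivity
  set c := (s : ℝ) * (β + pathRatio κ β 1) with hcd
  set w := κ - β - pathRatio κ β (a + 1) - c with hwd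
  set v := κ - β - pathRatio κ β b with hvd
  have hh : κ - β + 1 = 2 + 2 / w + 2 / v := by linarith
  have hhc : κ - β + 1 - c = 1 + pathRatio κ β (a + 1) + w := by rw [hwd]; ring
  have hhc0 : 0 < κ - β + 1 - c := by rw [hhc]; positivity
  rw [hρ]
  -- If `w` is large, moving the pendant edges to `w₂` suffices; otherwise `w < v τ`, and one path
  -- vertex is also moved to the `w₃` side.
  by_cases hor : 2 ≤ w ∨ v * pathRatio κ β (a + 1) ≤ w
  · left
    refine lt_alphaSpectralRadius_theta5 hα0 hα1 hκ hβ hρ0 s (a + 1) b ha hb (fun _ => hκβ)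
      (by linarith) hv (by linarith) hhc0 ?_
    have := one_lt_of_le_left (u := κ - β - pathRatio κ β (a + 1)) hw hv hτ hh (by ring)
      (by linarith) hor
    rwa [hwd, sub_sub_cancel] at this
  · right
    push Not at hor
    have hmono := pathRatio_lt_succ hβ0 a fun j hj => ha j (by omega)
    have hu' : κ - β - pathRatio κ β a = 1 / pathRatio κ β (a + 1) - β := by
      rw [pathRatio.eq_2, one_div_one_div]; ring
    have hu'0 : 0 < κ - β - pathRatio κ β a := by linarith
    have hvb : v + β = κ - pathRatio κ β b := by rw [hvd]; ring
    obtain ⟨hv', hlt⟩ := one_lt_of_lt_right (v' := κ - β - pathRatio κ β (b + 1)) hw hv hτ hβ0 hh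
      hor.2 hu' hu'0 (by rw [pathRatio, hvb]; ring)
    refine lt_alphaSpectralRadius_theta5 hα0 hα1 hκ hβ hρ0 s a (b + 1)
      (fun j hj => ha j (by omega)) ?_ (fun _ => hκβ) hu'0 hv' (by linarith) hhc0 ?_
    · intro j hj
      rcases Nat.lt_succ_iff_lt_or_eq.1 hj with h | h
      · exact hb j h
      · rw [h, ← hvb]; linarith
    · rwa [← hhc] at hlt

/-- Without pendant edges, moving the base towards the middle of the longest path increases the
`α`-spectral radius. -/
theorem theta4_lt_theta5_of_unbalanced {α : ℝ} (hα0 : 0 ≤ α) (hα1 : α < 1) (a b : ℕ)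
    (hab : b < a) :
    alphaSpectralRadius α (theta4 0 (a + 1) b) < alphaSpectralRadius α (theta5 0 a (b + 1)) := by
  obtain ⟨ρ, x, hx, hev, hρ⟩ := exists_pos_eigenvector hα0 hα1 (theta4 0 (a + 1) b)
    (attach_connected_and_diam 0 (.inr ⟨rfl, .inl (by omega)⟩)).1
  have h1 : 0 < 1 - α := by linarith
  set κ := (ρ - 2 * α) / (1 - α) with hκd
  set β := α / (1 - α) with hβd
  have hκ : (1 - α) * κ = ρ - 2 * α := by rw [hκd]; field_simp
  have hβ : (1 - α) * β = α := by rw [hβd]; field_simp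
  have hβ0 : 0 ≤ β := by positivity
  obtain ⟨ha, hb, -, hw, hv, hchar⟩ := theta4_relations hα1 hκ hβ 0 (a + 1) b x hx hev
  rw [Nat.cast_zero, zero_mul, sub_zero] at hw hchar
  have hk : 0 < κ - β - 1 := by rw [hchar]; positivity
  have hρ0 : 0 ≤ ρ := by
    have : 0 < (1 - α) * κ := mul_pos h1 (by linarith)
    linarith
  have hpa := ha a (by omega)
  have hτ : 0 < pathRatio κ β (a + 1) := by rw [pathRatio]; positivity
  -- The characteristic relation gives `(κ - β)(κ - β - 1) > 2`, and `2` is the positive root of `t²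
  -- - t - 2`.
  have hκ2 : 2 < κ - β := by
    have h2 : 2 / (κ - β) < κ - β - 1 := by
      have h3 : 2 / (κ - β) < 2 / (κ - β - pathRatio κ β (a + 1)) :=
        div_lt_div_of_pos_left two_pos hw (by linarith)
      have h4 : 0 < 2 / (κ - β - pathRatio κ β b) := by positivity
      linarith
    rw [div_lt_iff₀ (by linarith)] at h2
    nlinarith
  have hτlt := fun m => pathRatio_lt_one hβ0 (show 2 < κ by linarith) m
  have hinc := one_div_sub_pathRatio_add_lt hβ0 hκ2 hab
  rw [hρ]
  have hla := hτlt a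
  have hlb := hτlt (b + 1)
  refine lt_alphaSpectralRadius_theta5 hα0 hα1 hκ hβ hρ0 0 a (b + 1)
    (fun j _ => by linarith [hτlt j]) (fun j _ => by linarith [hτlt j]) (fun h => by omega)
    (by linarith) (by linarith) (by linarith) (by simp; linarith) ?_
  rw [Nat.cast_zero, zero_mul, sub_zero]
  -- At the original lengths `a + 1` and `b` this is an equality, the characteristic relation;
  -- concavity makes it strict at `a` and `b + 1`.
  have hsum : (κ - β + 1) / 2 < 1 + 1 / (κ - β - pathRatio κ β a) +
      1 / (κ - β - pathRatio κ β (b + 1)) := by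
    have e1 : 2 / (κ - β - pathRatio κ β (a + 1)) = 2 * (1 / (κ - β - pathRatio κ β (a + 1))) := by
      ring
    have e2 : 2 / (κ - β - pathRatio κ β b) = 2 * (1 / (κ - β - pathRatio κ β b)) := by ring
    rw [e1, e2] at hchar
    linarith
  have h2 : 0 < 1 / (κ - β + 1) + 1 / (κ - β + 1) := by
    have : 0 < κ - β + 1 := by linarith
    positivity
  calc 1 = (κ - β + 1) / 2 * (1 / (κ - β + 1) + 1 / (κ - β + 1)) := by
        have : κ - β + 1 ≠ 0 := by linarith
        field_simp; ring
    _ < _ := mul_lt_mul_of_pos_right hsum h2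

/-- A copy of `Θ₅(s; a, b)` on `Fin n`. -/
theorem exists_mem_Theta5Class {n d s a b : ℕ} (hn : n = 4 + s + a + b) (hd : d = a + b + 2) :
    ∃ H ∈ Theta5Class n d, Nonempty (H ≃g theta5 s a b) := by
  have hcard : Fintype.card (Fin n) = Fintype.card (AttachVertex s a b) := by
    simp [AttachVertex, hn]; ring
  let e := Fintype.equivOfCardEq hcard
  let f : (theta5 s a b).comap e ≃g theta5 s a b := SimpleGraph.Iso.comap e _
  refine ⟨(theta5 s a b).comap e, ⟨?_, s, a, b, ⟨f⟩⟩, ⟨f⟩⟩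
  rw [diam_eq_of_iso f, hd]
  exact (attach_connected_and_diam 1 (.inl rfl)).2

/-- Both moves preserve `s` and `a + b`, hence the order and the diameter, so the larger graph stays
in the class. -/
theorem exists_Theta5Class_lt_of_iso {α : ℝ} (hα0 : 0 ≤ α) (hα1 : α < 1) {n d s a b : ℕ}
    (H : SimpleGraph (Fin n)) (e : H ≃g theta4 s a b) (hdiam : H.diam = d)
    (has : 1 ≤ a ∨ s = 0) (hne : s = 0 → b + 1 < a) :
    ∃ H₂ ∈ Theta5Class n d, alphaSpectralRadius α H < alphaSpectralRadius α H₂ := by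
  have hd : d = a + b + 2 := by
    rw [← hdiam, diam_eq_of_iso e]
    exact (attach_connected_and_diam 0 (.inr ⟨rfl, has⟩)).2
  have hn : n = 4 + s + a + b := by
    have := Fintype.card_congr e.toEquiv
    simp [AttachVertex] at this
    omega
  obtain ⟨a, rfl⟩ : ∃ a', a = a' + 1 := ⟨a - 1, by have := hne; omega⟩
  have lift : ∀ {a' b' : ℕ}, a' + b' = a + 1 + b →
      alphaSpectralRadius α (theta4 s (a + 1) b) < alphaSpectralRadius α (theta5 s a' b') →
      ∃ H₂ ∈ Theta5Class n d, alphaSpectralRadius α H < alphaSpectralRadius α H₂ := by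
    intro a' b' hab hlt
    obtain ⟨H₂, hmem, ⟨f⟩⟩ :=
      exists_mem_Theta5Class (show n = 4 + s + a' + b' by omega) (show d = a' + b' + 2 by omega)
    refine ⟨H₂, hmem, ?_⟩
    rwa [alphaSpectralRadius_congr α e, alphaSpectralRadius_congr α f]
  rcases Nat.eq_zero_or_pos s with h0 | h0
  · subst h0
    have := hne rfl
    exact lift (by omega) (theta4_lt_theta5_of_unbalanced hα0 hα1 a b (by omega))
  · rcases theta4_lt_theta5_of_pendant hα0 hα1 s a b h0 with h | h
    · exact lift rfl h
    · exact lift (by omega) h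

/-- Without pendant edges the paths may be swapped so that the first is the longer. The excluded
lengths are the ceiling and floor of `(d - 2)/2`, so ruling them out in both orders leaves a gap of
at least two. -/
theorem exists_Theta5Class_lt_of_pos_or_no_pendant {α : ℝ} (hα0 : 0 ≤ α) (hα1 : α < 1)
    {n d s a b : ℕ} (H₁ : SimpleGraph (Fin n)) (e : H₁ ≃g theta4 s a b) (hdiam : H₁.diam = d)
    (hne : IsEmpty (H₁ ≃g theta4 0 ((d - 1) / 2) ((d - 2) / 2))) (has : 1 ≤ a ∨ s = 0) :
    ∃ H₂ ∈ Theta5Class n d, alphaSpectralRadius α H₁ < alphaSpectralRadius α H₂ := by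
  rcases Nat.eq_zero_or_pos s with h0 | h0
  · subst h0
    have hd : d = a + b + 2 := by
      rw [← hdiam, diam_eq_of_iso e]
      exact (attach_connected_and_diam 0 (.inr ⟨rfl, has⟩)).2
    have h1 : ¬ (a = (d - 1) / 2 ∧ b = (d - 2) / 2) := by
      rintro ⟨ha, hb⟩
      rw [← ha, ← hb] at hne
      exact hne.false e
    have e' : H₁ ≃g theta4 0 b a := e.trans (theta4SwapIso a b)
    have h2 : ¬ (b = (d - 1) / 2 ∧ a = (d - 2) / 2) := by
      rintro ⟨ha, hb⟩
      rw [← ha, ← hb] at hne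
      exact hne.false e'
    rcases le_total b a with h | h
    · exact exists_Theta5Class_lt_of_iso hα0 hα1 H₁ e hdiam (.inr rfl) fun _ => by omega
    · exact exists_Theta5Class_lt_of_iso hα0 hα1 H₁ e' hdiam (.inr rfl) fun _ => by omega
  · exact exists_Theta5Class_lt_of_iso hα0 hα1 H₁ e hdiam has fun h => by omega

end AlphaSpectral

theorem mainTheorem8 (α : ℝ) (hα0 : 0 ≤ α) (hα1 : α < 1) (n d : ℕ) (hd : 4 ≤ d)
    (H₁ : SimpleGraph (Fin n)) (hH₁ : H₁ ∈ AlphaSpectral.Theta4Class n d)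
    (hne : IsEmpty (H₁ ≃g AlphaSpectral.theta4 0 ((d - 1) / 2) ((d - 2) / 2))) :
    ∃ H₂ ∈ AlphaSpectral.Theta5Class n d,
      AlphaSpectral.alphaSpectralRadius α H₁ < AlphaSpectral.alphaSpectralRadius α H₂ := by
  obtain ⟨hdiam, s, a, b, ⟨e⟩⟩ := hH₁
  by_cases has : 1 ≤ a ∨ s = 0
  · exact AlphaSpectral.exists_Theta5Class_lt_of_pos_or_no_pendant hα0 hα1 H₁ e hdiam hne has
  -- One of the pendant edges is reread as a path of length one, so that `w₁` becomes interior to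
  -- the chain.
  · obtain rfl : a = 0 := by omega
    obtain ⟨s, rfl⟩ : ∃ s', s = s' + 1 := ⟨s - 1, by omega⟩
    exact AlphaSpectral.exists_Theta5Class_lt_of_pos_or_no_pendant hα0 hα1 H₁
      (e.trans (AlphaSpectral.theta4PendantIso s b)) hdiam hne (.inl le_rfl)
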